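/- Let $K$ be a finite field of characteristic $p$, let $G$ be a finite group, and let $B$ be a $p$-block of the group algebra $KG$, that is, $B = fKG$ for a primitive idempotent $f$ of the center of $KG$, regarded as a ring (a $K$-algebra) with identity $f$. A right ideal $I$ of $B$ is called checkable if there is an element $v \in B$ with $I = \{ b \in B \mid vb = 0 \}$. A module is called uniserial if it has exactly one composition series. The projective cover $P(M)$ of an irreducible $B$-module $M$ is the (up to isomorphism unique) indecomposable projective $B$-module which has a factor module isomorphic to $M$. Then the following are equivalent. (a) All right ideals of $B$ are checkable. (b) All left ideals of $B$ are principal. (c) Up to isomorphism, $B$ has exactly one irreducible left module $M$, and its projective cover $P(M)$ is uniserial. -/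

import Mathlib

universe u v

/-- A right ideal `I` of a ring `A` (a submodule of `A` for right multiplication) is *checkable*
if it is the right annihilator of a single element `v`. -/
def IsCheckable {A : Type*} [Ring A] (I : Submodule Aᵐᵒᵖ A) : Prop :=
  ∃ v : A, (I : Set A) = {a : A | v * a = 0}

/-- A *block idempotent* of a ring `A`: a primitive idempotent of the center of `A`. -/
structure IsBlockIdempotent {A : Type*} [Ring A] (f : A) : Prop where
  idem : IsIdempotentElem f
  mem_center : f ∈ Subring.center A
  ne_zero : f ≠ 0
  primitive : ∀ e₁ ∈ Subring.center A, ∀ e₂ ∈ Subring.center A,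
    IsIdempotentElem e₁ → IsIdempotentElem e₂ → e₁ * e₂ = 0 → f = e₁ + e₂ → e₁ = 0 ∨ e₂ = 0

/-- The *block* `f A = f A f` of a ring `A` belonging to the (central) block idempotent `f`; it is
a ring with the operations of `A` and with identity element `f`. -/
abbrev IsBlockIdempotent.Block {A : Type*} [Ring A] {f : A} (hf : IsBlockIdempotent f) : Type _ :=
  hf.idem.Corner

/-- A module is *uniserial* if it has exactly one composition series (from `0` to the module). -/
def IsUniserialModule (R M : Type*) [Ring R] [AddCommGroup M] [Module R M] : Prop :=
  ∃! s : CompositionSeries (Submodule R M), s.head = ⊥ ∧ s.last = ⊤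

/-- A module is *indecomposable* if it is nonzero and not an internal direct sum of two nonzero
submodules. -/
def IsIndecomposableModule (R M : Type*) [Ring R] [AddCommGroup M] [Module R M] : Prop :=
  Nontrivial M ∧ ∀ N₁ N₂ : Submodule R M, IsCompl N₁ N₂ → N₁ = ⊥ ∨ N₂ = ⊥

/-- `P` is a *projective cover* of the irreducible module `M`: an indecomposable projective module
with a factor module isomorphic to `M`. -/
structure IsProjectiveCover (R P M : Type*) [Ring R] [AddCommGroup P] [Module R P]
    [AddCommGroup M] [Module R M] : Prop where
  projective : Module.Projective R P
  indecomposable : IsIndecomposableModule R P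
  factor : ∃ N : Submodule R P, Nonempty ((P ⧸ N) ≃ₗ[R] M)

/-! Write `J` for the radical of `B`. (a) ⇔ (b): the coefficient of `1` gives a nondegenerate form
on `KG`, so one-sided ideals of `KG`, and then of `B`, equal their double annihilators. Taking
annihilators thus matches checkable right ideals with principal left ideals. (b) ⇒ (c): for
idempotents `e`, `g`, principality of `{b | be ∈ J} = Je ⊕ B(1-e)` bounds the size of `g(Je/J²e)` by
that of `g(Be/Je)` (`card_radical_quotient_le`). Hence an idempotent central modulo `J` is central.
A block has no central idempotents but `0` and `1`, which leaves a single simple module. For a local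
idempotent `e` the same bound gives `Je = By` with `y ∈ eJe`, so the submodules of `Be` form the
chain of the `B(ey^k)`. (c) ⇒ (b): uniseriality and uniqueness of `M` make every submodule of `P`,
hence of `P^n`, a quotient of `P` resp. `P^n`. If `B/J ≅ M^n`, then `B` embeds in `P^n` and maps
onto it, so each left ideal is a quotient of `B`. -/

section FiniteRing

variable {B : Type*} [Ring B]

/-! ### Idempotents and the radical of a finite ring -/

theorem exists_pow_isIdempotentElem {M : Type*} [Monoid M] [Finite M] (x : M) :
    ∃ n, 0 < n ∧ IsIdempotentElem (x ^ n) := by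
  obtain ⟨m, n, hmn, h⟩ := Finite.exists_ne_map_eq_of_infinite (fun n : ℕ => x ^ n)
  wlog hlt : m < n generalizing m n
  · exact this n m hmn.symm h.symm (by omega)
  obtain ⟨d, rfl⟩ := Nat.exists_eq_add_of_lt hlt
  have key : ∀ k a, m ≤ a → x ^ (a + k * (d + 1)) = x ^ a := by
    intro k
    induction k with
    | zero => simp
    | succ k ih =>
      intro a ha
      obtain ⟨c, rfl⟩ := Nat.exists_eq_add_of_le ha
      have h' : x ^ m = x ^ (m + d + 1) := h
      calc x ^ (m + c + (k + 1) * (d + 1)) = x ^ (m + d + 1) * x ^ (c + k * (d + 1)) := by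
            rw [← pow_add]; congr 1; ring
        _ = x ^ (m + c + k * (d + 1)) := by rw [← h', ← pow_add]; congr 1; ring
        _ = _ := ih _ ha
  -- A multiple of the period `d + 1` that is at least `m`: doubling it adds whole periods.
  refine ⟨(m + 1) * (d + 1), by positivity, ?_⟩
  rw [IsIdempotentElem, ← pow_add]
  exact key _ _ (by nlinarith)

/-- In a finite ring, a left ideal not contained in the radical contains a nonzero idempotent. -/
theorem exists_isIdempotentElem_mul_of_notMem_jacobson [Finite B] {b : B}
    (hb : b ∉ Ring.jacobson B) : ∃ c, IsIdempotentElem (c * b) ∧ c * b ≠ 0 := by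
  by_contra! H
  rw [Ring.jacobson_eq_sInf_isMaximal, Submodule.mem_sInf] at hb
  push Not at hb
  obtain ⟨m, hm, hbm⟩ := hb
  have hm' : Ideal.IsMaximal m := hm
  obtain ⟨c, z, hz, hcz⟩ := hm'.exists_inv hbm
  obtain ⟨n, hn, hid⟩ := exists_pow_isIdempotentElem (c * b)
  obtain ⟨k, rfl⟩ := Nat.exists_eq_add_of_lt hn
  have hnil : (c * b) ^ (0 + k + 1) = 0 := by
    have := H ((c * b) ^ (0 + k) * c)
    rw [mul_assoc, ← pow_succ] at this
    exact this hid
  have hu : IsUnit (1 - c * b) := IsNilpotent.isUnit_one_sub ⟨_, hnil⟩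
  have : z = 1 - c * b := by rw [← hcz]; abel
  exact hm'.ne_top (Ideal.eq_top_of_isUnit_mem _ hz (this ▸ hu))

theorem IsIdempotentElem.notMem_jacobson [IsArtinianRing B] {e : B} (he : IsIdempotentElem e)
    (h0 : e ≠ 0) : e ∉ Ring.jacobson B := by
  intro h
  obtain ⟨n, hn⟩ := IsSemiprimaryRing.isNilpotent (R := B)
  have h1 : e ^ n ∈ Ring.jacobson B ^ n := Ideal.pow_mem_pow h n
  rw [hn] at h1
  rcases Nat.eq_zero_or_pos n with rfl | hpos
  · have h10 : (1 : B) = 0 := by simpa using h1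
    exact h0 (by rw [← mul_one e, h10, mul_zero])
  · rw [he.pow_eq hpos.ne'] at h1
    exact h0 h1

/-- A nonzero idempotent `e` of a ring `B` such that every proper left ideal contained in `Be` lies
in the radical. -/
def IsLocalIdempotent (e : B) : Prop :=
  IsIdempotentElem e ∧ e ≠ 0 ∧ ∀ b, b * e ∉ Ring.jacobson B → ∃ c, c * (b * e) = e

/-- Take `e` with `eBe` smallest. An idempotent `g = c(be)` yields an idempotent `eg` of `eBe`, and
minimality forces `eg = e`. -/
theorem exists_isLocalIdempotent (B : Type*) [Ring B] [Finite B] [Nontrivial B] :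
    ∃ e : B, IsLocalIdempotent e := by
  obtain ⟨e, ⟨he, h0⟩, hmin⟩ := Set.exists_min_image
    {e : B | IsIdempotentElem e ∧ e ≠ 0} (fun e => Nat.card {x : B | e * x = x ∧ x * e = x})
    (Set.toFinite _) ⟨1, IsIdempotentElem.one, one_ne_zero⟩
  refine ⟨e, he, h0, fun b hb => ?_⟩
  obtain ⟨c, hc, hc0⟩ := exists_isIdempotentElem_mul_of_notMem_jacobson hb
  set g := c * (b * e) with hg
  have hge : g * e = g := by rw [hg]; simp only [mul_assoc, he.eq]
  have hid : IsIdempotentElem (e * g) := by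
    rw [IsIdempotentElem, mul_assoc, ← mul_assoc g, hge, hc.eq]
  have hne : e * g ≠ 0 := fun h => hc0 (by rw [← hc.eq]; nth_rw 1 [← hge]; rw [mul_assoc, h, mul_zero])
  have hle := hmin (e * g) ⟨hid, hne⟩
  have hsub : {x : B | e * g * x = x ∧ x * (e * g) = x} ⊆ {x : B | e * x = x ∧ x * e = x} := by
    rintro x ⟨h1, h2⟩
    refine ⟨?_, ?_⟩
    · rw [← h1]; simp only [← mul_assoc, he.eq]
    · rw [← h2]; simp only [mul_assoc, hge]
  have heq := Set.eq_of_subset_of_ncard_le hsub hle (Set.toFinite _)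
  have hmem : e ∈ {x : B | e * g * x = x ∧ x * (e * g) = x} := by
    rw [heq]; exact ⟨he, he⟩
  refine ⟨e * c, ?_⟩
  rw [mul_assoc, ← hg]
  have := hmem.1
  rwa [mul_assoc, hge] at this

/-- Every left ideal of the ring being principal bounds the radical quotients of the projective
modules `Be` by their heads. -/
theorem card_radical_quotient_le [Finite B] (hB : ∀ I : Ideal B, I.IsPrincipal) {e g : B}
    (he : IsIdempotentElem e) (hg : IsIdempotentElem g) :
    Nat.card ((fun b => Ideal.Quotient.mk (Ring.jacobson B * Ring.jacobson B) (g * b * e)) ''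
        (Ring.jacobson B : Set B)) ≤
      Nat.card (Set.range fun b => Ideal.Quotient.mk (Ring.jacobson B) (g * b * e)) := by
  set J := Ring.jacobson B with hJ
  let I : Ideal B := Submodule.comap (LinearMap.toSpanSingleton B B e) J
  have hI : ∀ b, b ∈ I ↔ b * e ∈ J := fun b => Iff.rfl
  obtain ⟨v, hv⟩ := hB I
  have hv' : ∀ b, b * e ∈ J → ∃ c, c * v = b := fun b hb => by
    have : b ∈ I := hb
    rw [hv] at this
    exact Submodule.mem_span_singleton.mp this
  have hvI : v * e ∈ J := by
    have : v ∈ I := hv ▸ Submodule.mem_span_singleton_self v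
    exact this
  have he' : (1 - e) * e = 0 := by rw [sub_mul, one_mul, he.eq, sub_self]
  have he'' : e * (1 - e) = 0 := by rw [mul_sub, mul_one, he.eq, sub_self]
  have he1 : (1 - e) * (1 - e) = 1 - e := he.one_sub.eq
  -- Since `I = Je ⊕ B(1-e)`, an element of `gI` can be prescribed in `T × S'`. As `I = Bv` and `ve
  -- ∈ J`, its class there depends only on the coefficient of `v` modulo `J`, a point of `S × S'`.
  -- Cancelling `S'` leaves the bound.
  let T := ((fun b => Ideal.Quotient.mk (J * J) (g * b * e)) '' (J : Set B))
  let S := (Set.range fun b => Ideal.Quotient.mk J (g * b * e))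
  let S' := (Set.range fun b => Ideal.Quotient.mk J (g * b * (1 - e)))
  have hch : ∀ p : T × S', ∃ x c : B, g * x = x ∧ c * v = x ∧
      Ideal.Quotient.mk (J * J) (x * e) = p.1.1 ∧ Ideal.Quotient.mk J (x * (1 - e)) = p.2.1 := by
    rintro ⟨⟨_, j, hj, rfl⟩, ⟨_, b, rfl⟩⟩
    have hxe : (g * j * e + g * b * (1 - e)) * e = g * j * e := by
      rw [add_mul, mul_assoc _ e, he.eq, mul_assoc _ (1 - e), he', mul_zero, add_zero]
    have hxe' : (g * j * e + g * b * (1 - e)) * (1 - e) = g * b * (1 - e) := by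
      rw [add_mul, mul_assoc _ e, he'', mul_assoc _ (1 - e), he1, mul_zero, zero_add]
    obtain ⟨c, hc⟩ := hv' (g * j * e + g * b * (1 - e)) (by
      rw [hxe]; exact Ideal.mul_mem_right _ _ (Ideal.mul_mem_left _ _ hj))
    refine ⟨g * j * e + g * b * (1 - e), c, ?_, hc, ?_, ?_⟩
    · rw [mul_add]; simp only [← mul_assoc, hg.eq]
    · rw [hxe]
    · rw [hxe']
  choose x c hx hc h1 h2 using hch
  let F : T × S' → S × S' := fun p =>
    (⟨Ideal.Quotient.mk J (g * c p * e), c p, rfl⟩,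
      ⟨Ideal.Quotient.mk J (g * c p * (1 - e)), c p, rfl⟩)
  have hF : Function.Injective F := by
    intro p q hpq
    have e1 : Ideal.Quotient.mk J (g * c p * e) = Ideal.Quotient.mk J (g * c q * e) :=
      congrArg (fun z => z.1.1) hpq
    have e2 : Ideal.Quotient.mk J (g * c p * (1 - e)) = Ideal.Quotient.mk J (g * c q * (1 - e)) :=
      congrArg (fun z => z.2.1) hpq
    rw [Ideal.Quotient.eq] at e1 e2
    have e3 : g * (c p - c q) ∈ J := by
      convert! J.add_mem e1 e2 using 1
      noncomm_ring
    have e4 : x p - x q = g * (c p - c q) * v := by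
      rw [mul_assoc, sub_mul, hc, hc, mul_sub, hx, hx]
    refine Prod.ext (Subtype.ext ?_) (Subtype.ext ?_)
    · rw [← h1, ← h1, Ideal.Quotient.eq, ← sub_mul, e4, mul_assoc]
      exact Ideal.mul_mem_mul e3 hvI
    · rw [← h2, ← h2, Ideal.Quotient.eq, ← sub_mul, e4]
      exact Ideal.mul_mem_right _ _ (Ideal.mul_mem_right _ _ e3)
  have : Finite (B ⧸ J) := Finite.of_surjective _ Ideal.Quotient.mk_surjective
  have hcard := Nat.card_le_card_of_injective F hF
  rw [Nat.card_prod, Nat.card_prod] at hcard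
  have : Nonempty S' := ⟨⟨_, 0, rfl⟩⟩
  exact Nat.le_of_mul_le_mul_right hcard Nat.card_pos

/-- The right side of `card_radical_quotient_le` is `1` here. -/
theorem mul_radical_mul_mem_radical_sq [Finite B] (hB : ∀ I : Ideal B, I.IsPrincipal) {e g : B}
    (he : IsIdempotentElem e) (hg : IsIdempotentElem g)
    (h : ∀ b, g * b * e ∈ Ring.jacobson B) (j : B) (hj : j ∈ Ring.jacobson B) :
    g * j * e ∈ Ring.jacobson B * Ring.jacobson B := by
  have hc := card_radical_quotient_le hB he hg
  have h1 : Set.range (fun b => Ideal.Quotient.mk (Ring.jacobson B) (g * b * e)) = {0} := by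
    ext z
    simp only [Set.mem_range, Set.mem_singleton_iff]
    constructor
    · rintro ⟨b, rfl⟩; exact Ideal.Quotient.eq_zero_iff_mem.mpr (h b)
    · rintro rfl; exact ⟨0, by simp⟩
  rw [h1, Nat.card_unique (α := ({0} : Set (B ⧸ Ring.jacobson B))),
    Finite.card_le_one_iff_subsingleton] at hc
  have := congrArg Subtype.val (hc.elim ⟨_, j, hj, rfl⟩ ⟨_, 0, zero_mem _, rfl⟩)
  rw [← Ideal.Quotient.eq_zero_iff_mem]
  simpa using this

/-- Right multiplication by `y` induces an injection of `Be/Je` into `Je` modulo `J²`, because `be ∉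
J` can be multiplied back to `e`. By the counting bound it is onto. -/
theorem IsLocalIdempotent.radical_generated [Finite B] (hB : ∀ I : Ideal B, I.IsPrincipal) {e y : B}
    (he : IsLocalIdempotent e) (hy : y ∈ Ring.jacobson B) (hey : e * y = y) (hye : y * e = y)
    (hy2 : y ∉ Ring.jacobson B * Ring.jacobson B) (j : B) (hj : j ∈ Ring.jacobson B) :
    ∃ b, j * e - b * y ∈ Ring.jacobson B * Ring.jacobson B := by
  set J := Ring.jacobson B with hJ
  have hc := card_radical_quotient_le hB he.1 IsIdempotentElem.one
  set T := ((fun b => Ideal.Quotient.mk (J * J) (1 * b * e)) '' (J : Set B))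
  set S := (Set.range fun b => Ideal.Quotient.mk J (1 * b * e))
  have hch : ∀ s : S, ∃ b, Ideal.Quotient.mk J (b * e) = s.1 := by
    rintro ⟨_, b, rfl⟩; exact ⟨b, by simp⟩
  choose β hβ using hch
  let F : S → T := fun s => ⟨Ideal.Quotient.mk (J * J) (β s * y), β s * y,
    Ideal.mul_mem_left _ _ hy, by simp only [one_mul, mul_assoc, hye]⟩
  have hF : Function.Injective F := by
    intro s t hst
    have h1 : Ideal.Quotient.mk (J * J) (β s * y) = Ideal.Quotient.mk (J * J) (β t * y) :=
      congrArg Subtype.val hst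
    rw [Ideal.Quotient.eq, ← sub_mul] at h1
    apply Subtype.ext
    rw [← hβ, ← hβ, Ideal.Quotient.eq, ← sub_mul]
    by_contra hne
    obtain ⟨c, hc⟩ := he.2.2 _ hne
    apply hy2
    rw [← hey, ← hc, mul_assoc, mul_assoc, hey]
    exact Ideal.mul_mem_left _ _ h1
  have hb : Function.Bijective F := hF.bijective_of_nat_card_le hc
  obtain ⟨s, hs⟩ := hb.2 ⟨_, j, hj, rfl⟩
  refine ⟨β s, ?_⟩
  have h1 : Ideal.Quotient.mk (J * J) (β s * y) = Ideal.Quotient.mk (J * J) (1 * j * e) :=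
    congrArg Subtype.val hs
  rw [← Ideal.Quotient.eq, h1, one_mul]

end FiniteRing

/-! ### Lifting centrality, and the chain of submodules of `Be` -/

section FiniteRing

variable {B : Type*} [Ring B]

/-- Insert `p + q = 1` in the middle: `pabq = pa·pbq + paq·bq`. -/
theorem mul_mul_one_sub_mem_pow_succ (J : Ideal B) [J.IsTwoSided] {p q : B} (hpq : p + q = 1)
    (k : ℕ) (h : ∀ b, p * b * q ∈ J ^ (k + 1)) {x : B} (hx : x ∈ J * J) :
    p * x * q ∈ J ^ (k + 2) := by
  induction hx using Submodule.smul_induction_on' with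
  | smul a ha b hb =>
    have : p * (a • b) * q = (p * a) * (p * b * q) + (p * a * q) * (b * q) := by
      have hp : p = 1 - q := eq_sub_of_add_eq hpq
      subst hp
      rw [smul_eq_mul]
      noncomm_ring
    rw [this]
    refine add_mem ?_ ?_
    · rw [Ideal.IsTwoSided.pow_succ]
      exact Ideal.mul_mem_mul (Ideal.mul_mem_left _ _ ha) (h b)
    · rw [Submodule.pow_succ]
      exact Ideal.mul_mem_mul (h a) (Ideal.mul_mem_right _ _ hb)
  | add x _ y _ hx hy => rw [mul_add, add_mul]; exact add_mem hx hy

/-- If the finite ring `B` has only principal left ideals, then an idempotent which is central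
modulo the radical is central. -/
theorem commute_of_mul_mul_one_sub_mem_jacobson [Finite B] (hB : ∀ I : Ideal B, I.IsPrincipal)
    {h : B} (hh : IsIdempotentElem h) (h1 : ∀ b, h * b * (1 - h) ∈ Ring.jacobson B)
    (h2 : ∀ b, (1 - h) * b * h ∈ Ring.jacobson B) (b : B) : b * h = h * b := by
  have hs : (1 - h) * (1 - h) = 1 - h := hh.one_sub.eq
  -- The two corners sink through the powers of `J`: they lie in `J²` by
  -- `mul_radical_mul_mem_radical_sq`, and then the previous lemma gains one power at each step.
  have key : ∀ k, (∀ b, h * b * (1 - h) ∈ Ring.jacobson B ^ (k + 1)) ∧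
      ∀ b, (1 - h) * b * h ∈ Ring.jacobson B ^ (k + 1) := by
    intro k
    induction k with
    | zero => simpa [Submodule.pow_one] using ⟨h1, h2⟩
    | succ k ih =>
      refine ⟨fun b => ?_, fun b => ?_⟩
      · have h3 := mul_radical_mul_mem_radical_sq hB hh.one_sub hh h1 _ (h1 b)
        have h4 := mul_mul_one_sub_mem_pow_succ _ (add_sub_cancel h 1) k ih.1 h3
        simpa only [mul_assoc, hs, hh.eq, hh.mul_self_mul] using h4
      · have h3 := mul_radical_mul_mem_radical_sq hB hh hh.one_sub h2 _ (h2 b)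
        have h4 := mul_mul_one_sub_mem_pow_succ _ (sub_add_cancel 1 h) k ih.2 h3
        simpa only [mul_assoc, hs, hh.eq, hh.one_sub.mul_self_mul] using h4
  obtain ⟨n, hn⟩ := IsSemiprimaryRing.isNilpotent (R := B)
  have h3 := (key n).1 b
  have h4 := (key n).2 b
  rw [Submodule.pow_succ, hn, zero_mul] at h3 h4
  have h3' : h * b * (1 - h) = 0 := h3
  have h4' : (1 - h) * b * h = 0 := h4
  rw [mul_sub, mul_one, sub_eq_zero] at h3'
  rw [sub_mul, sub_mul, one_mul, sub_eq_zero] at h4'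
  exact h4'.trans h3'.symm

/-- Take `h` with `Bh` largest. If `a(1-h) ∉ J`, there is a nonzero idempotent `g ∈ A` with `gh =
0`, and the idempotent `h + g - hg` generates a left ideal containing `h` and `g`, which is larger.
-/
theorem Ideal.exists_isIdempotentElem_mul_one_sub_mem_jacobson [Finite B] (A : Ideal B) :
    ∃ h ∈ A, IsIdempotentElem h ∧ ∀ a ∈ A, a * (1 - h) ∈ Ring.jacobson B := by
  obtain ⟨h, ⟨hh, hA⟩, hmax⟩ := Set.exists_max_image
    {h : B | IsIdempotentElem h ∧ h ∈ A} (fun h => Nat.card {x : B | x * h = x})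
    (Set.toFinite _) ⟨0, IsIdempotentElem.zero, A.zero_mem⟩
  refine ⟨h, hA, hh, fun a ha => ?_⟩
  by_contra hnot
  obtain ⟨c, hc, hc0⟩ := exists_isIdempotentElem_mul_of_notMem_jacobson hnot
  set g := c * (a * (1 - h)) with hg
  have hgA : g ∈ A := by
    refine A.mul_mem_left _ ?_
    rw [mul_sub, mul_one]
    exact A.sub_mem ha (A.mul_mem_left _ hA)
  have hgh : g * h = 0 := by
    rw [hg, mul_assoc, mul_assoc, sub_mul, one_mul, hh.eq, sub_self, mul_zero, mul_zero]
  have hx : ∀ x, x * h = x → x * (h + g - h * g) = x := fun x hx => by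
    rw [mul_sub, mul_add, hx, ← mul_assoc x h, hx, add_sub_cancel_right]
  have hgg : g * (h + g - h * g) = g := by
    rw [mul_sub, mul_add, hgh, ← mul_assoc g h, hgh, hc.eq]; simp
  have hid : IsIdempotentElem (h + g - h * g) := by
    rw [IsIdempotentElem, sub_mul, add_mul, hx h hh.eq, hgg, mul_assoc, hgg]
  have hle := hmax _ ⟨hid, A.sub_mem (A.add_mem hA hgA) (A.mul_mem_left _ hgA)⟩
  have hsub : {x : B | x * h = x} ⊆ {x : B | x * (h + g - h * g) = x} := hx
  have heq := Set.eq_of_subset_of_ncard_le hsub hle (Set.toFinite _)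
  have hmem : g ∈ {x : B | x * h = x} := by rw [heq]; exact hgg
  exact hc0 (by rw [← hgh]; exact hmem.symm)

/-- In a finite indecomposable ring with only principal left ideals, the radical is a maximal
two-sided ideal. -/
theorem Ideal.eq_top_of_isIdempotentElem_mem [Finite B] (hB : ∀ I : Ideal B, I.IsPrincipal)
    (hc : ∀ e : B, IsIdempotentElem e → (∀ b, b * e = e * b) → e = 0 ∨ e = 1)
    (A : Ideal B) [A.IsTwoSided] {e : B} (he : IsIdempotentElem e)
    (he0 : e ≠ 0) (heA : e ∈ A) : A = ⊤ := by
  obtain ⟨h, hA, hh, hr⟩ := A.exists_isIdempotentElem_mul_one_sub_mem_jacobson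
  have h1 : ∀ b, h * b * (1 - h) ∈ Ring.jacobson B := fun b => hr _ (A.mul_mem_right b hA)
  have h2 : ∀ b, (1 - h) * b * h ∈ Ring.jacobson B := by
    intro b
    by_contra hnot
    obtain ⟨c, hc, hc0⟩ := exists_isIdempotentElem_mul_of_notMem_jacobson hnot
    refine hc.notMem_jacobson hc0 ?_
    -- The square of this idempotent has the factor `h * c * (1 - h)`, which lies in `J`.
    rw [← hc.eq, show c * ((1 - h) * b * h) * (c * ((1 - h) * b * h)) =
      c * ((1 - h) * b) * (h * c * (1 - h)) * (b * h) by simp only [mul_assoc]]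
    exact Ideal.mul_mem_right _ _ (Ideal.mul_mem_left _ _ (h1 c))
  rcases hc h hh (commute_of_mul_mul_one_sub_mem_jacobson hB hh h1 h2) with rfl | rfl
  · have := hr e heA
    rw [sub_zero, mul_one] at this
    exact (he.notMem_jacobson he0 this).elim
  · exact (Ideal.eq_top_iff_one A).mpr hA

/-- Nakayama by iteration: feeding an approximation modulo `J^(k+1)` into the error term in `J²`
improves it to `J^(k+2)`, and `J` is nilpotent. -/
theorem IsLocalIdempotent.exists_mul_eq_of_sq [Finite B] {e y : B} (he : IsIdempotentElem e)
    (hye : y * e = y)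
    (h : ∀ j ∈ Ring.jacobson B, ∃ b, j * e - b * y ∈ Ring.jacobson B * Ring.jacobson B)
    {j : B} (hj : j ∈ Ring.jacobson B) : ∃ b, j * e = b * y := by
  set J := Ring.jacobson B with hJ
  have key : ∀ k, ∀ j ∈ J, ∃ b, j * e - b * y ∈ J ^ (k + 1) := by
    intro k
    induction k with
    | zero =>
      intro j hj
      obtain ⟨b, hb⟩ := h j hj
      exact ⟨b, by simpa [Submodule.pow_one] using Ideal.mul_le_left hb⟩
    | succ k ih =>
      have hsq : ∀ z ∈ J * J, ∃ b, z * e - b * y ∈ J ^ (k + 2) := by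
        intro z hz
        induction hz using Submodule.smul_induction_on' with
        | smul a ha c hc =>
          obtain ⟨b, hb⟩ := ih c hc
          refine ⟨a * b, ?_⟩
          rw [smul_eq_mul, mul_assoc, mul_assoc, ← mul_sub, Ideal.IsTwoSided.pow_succ]
          exact Ideal.mul_mem_mul ha hb
        | add x _ z _ hx hz =>
          obtain ⟨b, hb⟩ := hx
          obtain ⟨c, hc⟩ := hz
          refine ⟨b + c, ?_⟩
          convert! add_mem hb hc using 1
          noncomm_ring
      intro j hj
      obtain ⟨b, hb⟩ := h j hj
      obtain ⟨c, hc⟩ := hsq _ hb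
      refine ⟨b + c, ?_⟩
      convert! hc using 1
      rw [sub_mul, mul_assoc, he.eq, mul_assoc, hye, add_mul, sub_sub]
  obtain ⟨n, hn⟩ := IsSemiprimaryRing.isNilpotent (R := B)
  obtain ⟨b, hb⟩ := key n j hj
  rw [← hJ] at hn
  rw [Submodule.pow_succ, hn, zero_mul] at hb
  exact ⟨b, sub_eq_zero.mp hb⟩

/-- Unless `Je ⊆ J²`, the two-sided ideal `{b | bJe ⊆ J²}` is proper, so it does not contain `e`;
hence some `eje` lies outside `J²` and generates. -/
theorem IsLocalIdempotent.exists_radical_generator [Finite B] (hB : ∀ I : Ideal B, I.IsPrincipal)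
    (hc : ∀ e : B, IsIdempotentElem e → (∀ b, b * e = e * b) → e = 0 ∨ e = 1)
    {e : B} (he : IsLocalIdempotent e) :
    ∃ y ∈ Ring.jacobson B, e * y = y ∧ y * e = y ∧
      ∀ j ∈ Ring.jacobson B, ∃ b, j * e = b * y := by
  by_cases hsq : ∀ j ∈ Ring.jacobson B, j * e ∈ Ring.jacobson B * Ring.jacobson B
  · refine ⟨0, zero_mem _, mul_zero _, zero_mul _, fun j hj => ?_⟩
    exact exists_mul_eq_of_sq he.1 (zero_mul _) (fun j hj => ⟨0, by simpa using hsq j hj⟩) hj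
  · let A : Ideal B :=
      { carrier := {b | ∀ j ∈ Ring.jacobson B, b * j * e ∈ Ring.jacobson B * Ring.jacobson B}
        add_mem' := fun ha hb j hj => by
          rw [add_mul, add_mul]; exact add_mem (ha j hj) (hb j hj)
        zero_mem' := fun j _ => by simp
        smul_mem' := fun c b hb j hj => by
          rw [smul_eq_mul, mul_assoc, mul_assoc, ← mul_assoc b]
          exact Ideal.mul_mem_left _ _ (hb j hj) }
    have : A.IsTwoSided := ⟨fun {a} b ha j hj => by
      rw [mul_assoc a]; exact ha _ (Ideal.mul_mem_left _ _ hj)⟩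
    have heA : e ∉ A := fun heA => hsq fun j hj => by
      have h1 : (1 : B) ∈ A := by
        rw [A.eq_top_of_isIdempotentElem_mem hB hc he.1 he.2.1 heA]; trivial
      simpa using h1 j hj
    obtain ⟨j, hj, hej⟩ : ∃ j ∈ Ring.jacobson B,
        e * j * e ∉ Ring.jacobson B * Ring.jacobson B := by
      by_contra! hcon; exact heA hcon
    have hyJ : e * j * e ∈ Ring.jacobson B := Ideal.mul_mem_right _ _ (Ideal.mul_mem_left _ _ hj)
    have hey : e * (e * j * e) = e * j * e := by simp only [← mul_assoc, he.1.eq]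
    have hye : e * j * e * e = e * j * e := by rw [mul_assoc, he.1.eq]
    exact ⟨_, hyJ, hey, hye, fun i hi => exists_mul_eq_of_sq he.1 hye
      (he.radical_generated hB hyJ hey hye hej) hi⟩

/-- A coefficient of `ey^n` that lies in `J` releases one more factor `y`; one outside `J` can be
inverted up to `e`. Nilpotency of `y` ends the process. -/
theorem IsLocalIdempotent.exists_pow [Finite B] {e y : B} (he : IsLocalIdempotent e)
    (hy : y ∈ Ring.jacobson B) (hey : e * y = y)
    (hgen : ∀ j ∈ Ring.jacobson B, ∃ b, j * e = b * y) (b : B) :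
    ∃ k d u, b * e = d * (e * y ^ k) ∧ u * (b * e) = e * y ^ k := by
  have key : ∀ n, (∃ k d u, b * e = d * (e * y ^ k) ∧ u * (b * e) = e * y ^ k) ∨
      ∃ b', b * e = b' * (e * y ^ n) := by
    intro n
    induction n with
    | zero => exact Or.inr ⟨b, by simp⟩
    | succ n ih =>
      refine ih.elim Or.inl ?_
      rintro ⟨b', hb'⟩
      by_cases hbJ : b' * e ∈ Ring.jacobson B
      · obtain ⟨c, hc⟩ := hgen _ hbJ
        refine Or.inr ⟨c, ?_⟩
        rw [mul_assoc, he.1.eq] at hc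
        rw [hb', ← mul_assoc, hc, pow_succ', ← mul_assoc e, hey, mul_assoc]
      · obtain ⟨c, hc⟩ := he.2.2 _ hbJ
        exact Or.inl ⟨n, b', c, hb', by rw [hb', ← mul_assoc b', ← mul_assoc, hc]⟩
  obtain ⟨n, hn⟩ := IsSemiprimaryRing.isNilpotent (R := B)
  have hyn : y ^ n = 0 := by
    have h1 := Ideal.pow_mem_pow hy n
    rw [hn] at h1
    exact h1
  refine (key n).elim id ?_
  rintro ⟨b', hb'⟩
  exact ⟨n, b', 0, hb', by simp [hyn]⟩

theorem IsLocalIdempotent.dvd_total [Finite B] (hB : ∀ I : Ideal B, I.IsPrincipal)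
    (hc : ∀ e : B, IsIdempotentElem e → (∀ b, b * e = e * b) → e = 0 ∨ e = 1)
    {e : B} (he : IsLocalIdempotent e) (a b : B) :
    (∃ c, c * (a * e) = b * e) ∨ ∃ c, c * (b * e) = a * e := by
  obtain ⟨y, hy, hey, hye, hgen⟩ := he.exists_radical_generator hB hc
  obtain ⟨k, d, u, h1, h2⟩ := he.exists_pow hy hey hgen a
  obtain ⟨l, d', u', h1', h2'⟩ := he.exists_pow hy hey hgen b
  have hcomm : Commute e y := hey.trans hye.symm
  have hpow : ∀ m n, (e * y ^ m) * (e * y ^ n) = e * y ^ (m + n) := fun m n => by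
    rw [mul_assoc, ← mul_assoc (y ^ m), ← (hcomm.pow_right m).eq, mul_assoc, ← pow_add,
      ← mul_assoc, he.1.eq]
  rcases le_total k l with hkl | hkl
  · left
    obtain ⟨m, rfl⟩ := Nat.exists_eq_add_of_le' hkl
    exact ⟨d' * ((e * y ^ m) * u), by rw [h1', ← hpow, ← h2]; simp only [mul_assoc]⟩
  · right
    obtain ⟨m, rfl⟩ := Nat.exists_eq_add_of_le' hkl
    exact ⟨d * ((e * y ^ m) * u'), by rw [h1, ← hpow, ← h2']; simp only [mul_assoc]⟩

end FiniteRing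

/-! ### Uniserial modules and chains of submodules -/

section Uniserial

variable {R M : Type*} [Ring R] [AddCommGroup M] [Module R M]

theorem CompositionSeries.mem_of_total (htot : ∀ N₁ N₂ : Submodule R M, N₁ ≤ N₂ ∨ N₂ ≤ N₁)
    {s : CompositionSeries (Submodule R M)} (h0 : s.head = ⊥) (h1 : s.last = ⊤)
    (N : Submodule R M) : N ∈ s := by
  by_contra hN
  have key : ∀ i, s i ≤ N := by
    intro i
    induction i using Fin.induction with
    | zero => exact h0.le.trans bot_le
    | succ i ih =>
      refine (htot _ _).resolve_right fun hle => hN ?_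
      have hcov : s i.castSucc ⋖ s i.succ := s.step i
      rcases hcov.eq_or_eq ih hle with h | h
      · exact ⟨_, h.symm⟩
      · exact ⟨_, h.symm⟩
  refine hN ⟨Fin.last _, ?_⟩
  exact h1.trans (top_le_iff.mp (h1.symm.le.trans (key (Fin.last _)))).symm

theorem isUniserialModule_of_total [IsNoetherian R M] [IsArtinian R M]
    (htot : ∀ N₁ N₂ : Submodule R M, N₁ ≤ N₂ ∨ N₂ ≤ N₁) : IsUniserialModule R M := by
  obtain ⟨s, hs0, hs1⟩ := exists_compositionSeries_of_isNoetherian_isArtinian R M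
  refine ⟨s, ⟨hs0, hs1⟩, fun t ht => CompositionSeries.ext fun N => ?_⟩
  exact iff_of_true (CompositionSeries.mem_of_total htot ht.1 ht.2 N)
    (CompositionSeries.mem_of_total htot hs0 hs1 N)

/-- Series of `N` and `M ⧸ N` are glued at `N`. If the composition series is unique, it then
contains all submodules, which are therefore comparable. -/
theorem CompositionSeries.exists_mem [IsNoetherian R M] [IsArtinian R M] (N : Submodule R M) :
    ∃ s : CompositionSeries (Submodule R M), s.head = ⊥ ∧ s.last = ⊤ ∧ N ∈ s := by
  obtain ⟨s, hs₁, hs₂⟩ := exists_compositionSeries_of_isNoetherian_isArtinian R (M ⧸ N)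
  obtain ⟨t, ht₁, ht₂⟩ := exists_compositionSeries_of_isNoetherian_isArtinian R N
  let s' : CompositionSeries (Submodule R M) :=
    s.map ⟨Submodule.comap N.mkQ, Submodule.comap_covBy_of_surjective N.mkQ_surjective⟩
  let t' : CompositionSeries (Submodule R M) :=
    t.map ⟨Submodule.map N.subtype, Submodule.map_covBy_of_injective N.injective_subtype⟩
  have h1 : t'.last = N := by
    change Submodule.map N.subtype t.last = N
    rw [ht₂, Submodule.map_top, Submodule.range_subtype]
  have h2 : s'.head = N := by
    change Submodule.comap N.mkQ s.head = N
    rw [hs₁, Submodule.comap_bot, Submodule.ker_mkQ]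
  refine ⟨t'.smash s' (h1.trans h2.symm), ?_, ?_, ?_⟩
  · rw [RelSeries.head_smash]
    change Submodule.map N.subtype t.head = ⊥
    rw [ht₁, Submodule.map_bot]
  · rw [RelSeries.last_smash]
    change Submodule.comap N.mkQ s.last = ⊤
    rw [hs₂, Submodule.comap_top]
  · exact ⟨_, (RelSeries.smash_castLE _ (Fin.last _)).trans h1⟩

theorem IsUniserialModule.isNoetherian_isArtinian (h : IsUniserialModule R M) :
    IsNoetherian R M ∧ IsArtinian R M :=
  isFiniteLength_iff_isNoetherian_isArtinian.mp
    (isFiniteLength_of_exists_compositionSeries h.exists)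

theorem IsUniserialModule.total (h : IsUniserialModule R M) (N₁ N₂ : Submodule R M) :
    N₁ ≤ N₂ ∨ N₂ ≤ N₁ := by
  obtain ⟨_, _⟩ := h.isNoetherian_isArtinian
  obtain ⟨s, hs0, hs1, hs⟩ := CompositionSeries.exists_mem N₁
  obtain ⟨t, ht0, ht1, ht⟩ := CompositionSeries.exists_mem N₂
  obtain rfl := h.unique ⟨hs0, hs1⟩ ⟨ht0, ht1⟩
  exact CompositionSeries.total hs ht

end Uniserial

/-! ### The simple module and its projective cover -/

section ProjectiveCover

variable {B : Type*} [Ring B]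

theorem IsLocalIdempotent.span_eq_top {e : B} (he : IsLocalIdempotent e)
    {N : Submodule B (Ideal.span {e})} {x : Ideal.span {e}} (hxN : x ∈ N)
    (hx : (x : B) ∉ Ring.jacobson B) : N = ⊤ := by
  rw [eq_top_iff]
  rintro ⟨z, hz⟩ -
  obtain ⟨⟨b, hb⟩, d, hd⟩ :=
    And.intro (Ideal.mem_span_singleton'.mp x.2) (Ideal.mem_span_singleton'.mp hz)
  rw [← hb] at hx
  obtain ⟨c, hc⟩ := he.2.2 b hx
  have : (⟨z, hz⟩ : Ideal.span {e}) = (d * c) • x := by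
    apply Subtype.ext
    rw [Submodule.coe_smul, smul_eq_mul, ← hb, mul_assoc, hc, hd]
  rw [this]
  exact N.smul_mem _ hxN

theorem IsIdempotentElem.projective_span {e : B} (he : IsIdempotentElem e) :
    Module.Projective B (Ideal.span {e}) := by
  refine Module.Projective.of_split (Ideal.span {e}).subtype
    ((LinearMap.toSpanSingleton B B e).codRestrict (Ideal.span {e})
      fun b => Ideal.mul_mem_left _ _ (Ideal.mem_span_singleton_self e)) ?_
  ext ⟨x, hx⟩
  obtain ⟨b, rfl⟩ := Ideal.mem_span_singleton'.mp hx
  change b * e * e = b * e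
  rw [mul_assoc, he.eq]

theorem isIndecomposableModule_of_total {R M : Type*} [Ring R] [AddCommGroup M] [Module R M]
    [Nontrivial M] (htot : ∀ N₁ N₂ : Submodule R M, N₁ ≤ N₂ ∨ N₂ ≤ N₁) :
    IsIndecomposableModule R M := by
  refine ⟨inferInstance, fun N₁ N₂ h => ?_⟩
  rcases htot N₁ N₂ with hle | hle
  · exact Or.inl (h.disjoint.eq_bot_of_le hle)
  · exact Or.inr (h.disjoint.symm.eq_bot_of_le hle)

theorem IsLocalIdempotent.submodule_total [Finite B] (hB : ∀ I : Ideal B, I.IsPrincipal)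
    (hc : ∀ e : B, IsIdempotentElem e → (∀ b, b * e = e * b) → e = 0 ∨ e = 1)
    {e : B} (he : IsLocalIdempotent e) (N₁ N₂ : Submodule B (Ideal.span {e})) :
    N₁ ≤ N₂ ∨ N₂ ≤ N₁ := by
  by_contra! hcon
  obtain ⟨⟨x, hx1, hx2⟩, ⟨y, hy2, hy1⟩⟩ :=
    And.intro (SetLike.not_le_iff_exists.mp hcon.1) (SetLike.not_le_iff_exists.mp hcon.2)
  obtain ⟨a, ha⟩ := Ideal.mem_span_singleton'.mp x.2
  obtain ⟨b, hb⟩ := Ideal.mem_span_singleton'.mp y.2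
  rcases he.dvd_total hB hc a b with ⟨c, h⟩ | ⟨c, h⟩
  · have : y = c • x := Subtype.ext (by rw [Submodule.coe_smul, smul_eq_mul, ← ha, h, hb])
    exact hy1 (this ▸ N₁.smul_mem _ hx1)
  · have : x = c • y := Subtype.ext (by rw [Submodule.coe_smul, smul_eq_mul, ← hb, h, ha])
    exact hx2 (this ▸ N₂.smul_mem _ hy2)

/-- A finite indecomposable ring all of whose left ideals are principal has exactly one simple
module, and its projective cover is uniserial. -/
theorem exists_uniserial_projectiveCover {B : Type u} [Ring B] [Finite B] [Nontrivial B]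
    (hB : ∀ I : Ideal B, I.IsPrincipal)
    (hc : ∀ e : B, IsIdempotentElem e → (∀ b, b * e = e * b) → e = 0 ∨ e = 1) :
    ∃ (M : Type u) (_ : AddCommGroup M) (_ : Module B M), IsSimpleModule B M ∧
      (∀ (N : Type u) [AddCommGroup N] [Module B N], IsSimpleModule B N → Nonempty (N ≃ₗ[B] M)) ∧
      ∃ (P : Type u) (_ : AddCommGroup P) (_ : Module B P),
        IsProjectiveCover B P M ∧ IsUniserialModule B P := by
  obtain ⟨e, he⟩ := exists_isLocalIdempotent B
  let P := Ideal.span {e}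
  let e' : P := ⟨e, Ideal.mem_span_singleton_self e⟩
  let Q : Submodule B P := Submodule.comap (Submodule.subtype P) (Ring.jacobson B)
  have heQ : e' ∉ Q := he.1.notMem_jacobson he.2.1
  have hQ : IsCoatom Q := by
    refine ⟨fun h => heQ (h ▸ trivial), fun N hN => ?_⟩
    obtain ⟨x, hx, hxQ⟩ := SetLike.exists_of_lt hN
    exact he.span_eq_top hx hxQ
  have : Nontrivial P := ⟨⟨e', 0, fun h => he.2.1 (congrArg Subtype.val h)⟩⟩
  have htot := he.submodule_total hB hc
  refine ⟨P ⧸ Q, inferInstance, inferInstance, isSimpleModule_iff_isCoatom.mpr hQ, ?_,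
    P, inferInstance, inferInstance,
    ⟨he.1.projective_span, isIndecomposableModule_of_total htot, Q, ⟨LinearEquiv.refl _ _⟩⟩,
    isUniserialModule_of_total htot⟩
  intro N _ _ hN
  -- Otherwise the annihilator of `N`, a two-sided ideal, would contain the idempotent `e` and so be
  -- the whole ring.
  obtain ⟨x, hx⟩ : ∃ x : N, e • x ≠ 0 := by
    by_contra! hcon
    have htop := (Module.annihilator B N).eq_top_of_isIdempotentElem_mem hB hc he.1 he.2.1
      (Module.mem_annihilator.mpr hcon)
    have := hN.nontrivial
    obtain ⟨z, hz⟩ := exists_ne (0 : N)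
    refine hz ?_
    rw [← one_smul B z]
    exact Module.mem_annihilator.mp (htop ▸ trivial : (1 : B) ∈ Module.annihilator B N) z
  let φ : P →ₗ[B] N := (LinearMap.toSpanSingleton B N x).comp (Submodule.subtype P)
  have hφ : φ e' ≠ 0 := hx
  have hφ0 : φ ≠ 0 := fun h => hφ (by rw [h]; rfl)
  have hsurj : Function.Surjective φ := LinearMap.surjective_of_ne_zero hφ0
  have hker : IsCoatom (LinearMap.ker φ) := LinearMap.isCoatom_ker_of_surjective hsurj
  have hle : LinearMap.ker φ ≤ Q := fun p hp => by
    by_contra hpQ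
    exact hker.1 (he.span_eq_top hp hpQ)
  have heq : Q = LinearMap.ker φ := (hker.le_iff_eq hQ.1).mp hle
  exact ⟨((Submodule.quotEquivOfEq _ _ heq).trans (φ.quotKerEquivOfSurjective hsurj)).symm⟩

end ProjectiveCover

/-! ### From a uniserial projective cover to principal left ideals -/

section UniserialProjectiveCover

variable {B : Type u} [Ring B]

theorem Submodule.eq_top_of_total {P M : Type*} [AddCommGroup P] [Module B P] [AddCommGroup M]
    [Module B M] [IsSimpleModule B M] (htot : ∀ N₁ N₂ : Submodule B P, N₁ ≤ N₂ ∨ N₂ ≤ N₁)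
    {q : P →ₗ[B] M} (hq : Function.Surjective q) {T : Submodule B P}
    (hT : ¬ T ≤ LinearMap.ker q) : T = ⊤ :=
  (LinearMap.isCoatom_ker_of_surjective hq).2 T
    (lt_of_le_of_ne ((htot _ _).resolve_left hT) fun h => hT h.ge)

/-- A nonzero `X` has a simple quotient, necessarily `M`. Lifting `q` along it gives `P → X`, whose
range is not in the maximal submodule and so is everything, as the submodules of `X` form a chain.
-/
theorem exists_surjective_of_injective_of_total {M P X : Type u} [AddCommGroup M] [Module B M]
    [AddCommGroup P] [Module B P] [AddCommGroup X] [Module B X]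
    (huniq : ∀ (N : Type u) [AddCommGroup N] [Module B N],
      IsSimpleModule B N → Nonempty (N ≃ₗ[B] M))
    [IsSimpleModule B M] [Module.Projective B P] [IsNoetherian B P]
    (htot : ∀ N₁ N₂ : Submodule B P, N₁ ≤ N₂ ∨ N₂ ≤ N₁) {q : P →ₗ[B] M}
    (hq : Function.Surjective q) {φ : X →ₗ[B] P} (hφ : Function.Injective φ) :
    ∃ α : P →ₗ[B] X, Function.Surjective α := by
  have hX : IsNoetherian B X := isNoetherian_of_injective φ hφ
  rcases subsingleton_or_nontrivial X with _ | _
  · exact ⟨0, fun x => ⟨0, Subsingleton.elim _ _⟩⟩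
  obtain ⟨C, hC⟩ := IsCoatomic.exists_coatom (α := Submodule B X)
  have hXC : IsSimpleModule B (X ⧸ C) := isSimpleModule_iff_isCoatom.mpr hC
  obtain ⟨ε⟩ := huniq (X ⧸ C) hXC
  let r : X →ₗ[B] M := ε.toLinearMap.comp C.mkQ
  have hr : Function.Surjective r := ε.surjective.comp C.mkQ_surjective
  obtain ⟨α, hα⟩ := Module.projective_lifting_property r q hr
  have htot' : ∀ N₁ N₂ : Submodule B X, N₁ ≤ N₂ ∨ N₂ ≤ N₁ := fun N₁ N₂ => by
    rw [← Submodule.map_le_map_iff_of_injective hφ, ← Submodule.map_le_map_iff_of_injective hφ]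
    exact htot _ _
  refine ⟨α, LinearMap.range_eq_top.mp (Submodule.eq_top_of_total htot' hr fun hle => ?_)⟩
  have := IsSimpleModule.nontrivial B M
  obtain ⟨m, hm⟩ := exists_ne (0 : M)
  obtain ⟨p, rfl⟩ := hq m
  refine hm ?_
  rw [← hα]
  exact hle ⟨p, rfl⟩

/-- Horseshoe argument: the first coordinate of `φ` has image in `P` and kernel embedded in `P^n`;
projectivity lifts the cover of the image to `X`. -/
theorem exists_surjective_of_injective_pi {P : Type u} [AddCommGroup P] [Module B P]
    [Module.Projective B P]
    (h : ∀ (X : Type u) [AddCommGroup X] [Module B X] (φ : X →ₗ[B] P), Function.Injective φ →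
      ∃ α : P →ₗ[B] X, Function.Surjective α) (n : ℕ) :
    ∀ (X : Type u) [AddCommGroup X] [Module B X] (φ : X →ₗ[B] (Fin n → P)),
      Function.Injective φ → ∃ α : (Fin n → P) →ₗ[B] X, Function.Surjective α := by
  induction n with
  | zero =>
    intro X _ _ φ hφ
    exact ⟨0, fun x => ⟨0, hφ (Subsingleton.elim _ _)⟩⟩
  | succ n ih =>
    intro X _ _ φ hφ
    let φ₀ : X →ₗ[B] P := (LinearMap.proj 0).comp φ
    let tail : (Fin (n + 1) → P) →ₗ[B] (Fin n → P) := LinearMap.funLeft B P Fin.succ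
    obtain ⟨ψ, hψ⟩ := ih (LinearMap.ker φ₀) ((tail.comp φ).comp (LinearMap.ker φ₀).subtype) (by
      intro x y hxy
      apply Subtype.ext
      apply hφ
      funext i
      refine Fin.cases ?_ (fun j => congrFun hxy j) i
      exact (LinearMap.mem_ker.mp x.2).trans (LinearMap.mem_ker.mp y.2).symm)
    obtain ⟨a, ha⟩ := h (LinearMap.range φ₀) (LinearMap.range φ₀).subtype
      (Submodule.injective_subtype _)
    obtain ⟨a', ha'⟩ := Module.projective_lifting_property φ₀.rangeRestrict a
      φ₀.surjective_rangeRestrict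
    refine ⟨a'.comp (LinearMap.proj 0) + ((LinearMap.ker φ₀).subtype.comp ψ).comp tail,
      fun x => ?_⟩
    obtain ⟨p, hp⟩ := ha (φ₀.rangeRestrict x)
    have hmem : x - a' p ∈ LinearMap.ker φ₀ := by
      rw [LinearMap.mem_ker, map_sub, sub_eq_zero]
      rw [← ha'] at hp
      exact (congrArg Subtype.val hp).symm
    obtain ⟨w, hw⟩ := hψ ⟨_, hmem⟩
    refine ⟨Fin.cons p w, ?_⟩
    have htail : tail (Fin.cons p w) = w := by ext i; simp [tail, LinearMap.funLeft]
    have hw' : ((ψ w : LinearMap.ker φ₀) : X) = x - a' p := congrArg Subtype.val hw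
    simp [htail, hw']

/-- Since `ker q` is the only maximal submodule of `P`, every maximal submodule of `P^n` contains
`(ker q)^n`, so none contains the range of `f`. -/
theorem surjective_of_surjective_pi_comp {P M Y : Type*} [AddCommGroup P] [Module B P]
    [AddCommGroup M] [Module B M] [AddCommGroup Y] [Module B Y] [IsSimpleModule B M]
    [IsNoetherian B P] (htot : ∀ N₁ N₂ : Submodule B P, N₁ ≤ N₂ ∨ N₂ ≤ N₁) {q : P →ₗ[B] M}
    (hq : Function.Surjective q) {n : ℕ} {f : Y →ₗ[B] (Fin n → P)}
    (hf : ∀ m : Fin n → M, ∃ y, ∀ i, q (f y i) = m i) : Function.Surjective f := by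
  rw [← LinearMap.range_eq_top]
  by_contra hne
  obtain ⟨T, hT, hle⟩ := (eq_top_or_exists_le_coatom (LinearMap.range f)).resolve_left hne
  have hsimple : IsSimpleModule B ((Fin n → P) ⧸ T) := isSimpleModule_iff_isCoatom.mpr hT
  have key : ∀ i, ∀ x ∈ LinearMap.ker q, Pi.single i x ∈ T := by
    intro i x hx
    let φ : P →ₗ[B] ((Fin n → P) ⧸ T) := T.mkQ.comp (LinearMap.single B (fun _ => P) i)
    suffices hxφ : φ x = 0 from (Submodule.Quotient.mk_eq_zero T).mp hxφ
    by_cases hφ : φ = 0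
    · rw [hφ]; rfl
    · by_contra hxφ
      have hsurj : Function.Surjective φ := LinearMap.surjective_of_ne_zero hφ
      exact (LinearMap.isCoatom_ker_of_surjective hq).1
        (Submodule.eq_top_of_total htot hsurj fun hker => hxφ (hker hx))
  refine hT.1 (eq_top_iff.mpr fun z _ => ?_)
  obtain ⟨y, hy⟩ := hf fun i => q (z i)
  have hsum : z - f y = ∑ i, Pi.single i ((z - f y) i) := (Finset.univ_sum_single _).symm
  have hmem : z - f y ∈ T := by
    rw [hsum]
    refine T.sum_mem fun i _ => key i _ ?_
    rw [LinearMap.mem_ker, Pi.sub_apply, map_sub, hy, sub_self]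
  have := T.add_mem hmem (hle ⟨y, rfl⟩)
  rwa [sub_add_cancel] at this

theorem exists_quotient_jacobson_equiv_pi [IsArtinianRing B] {M : Type u} [AddCommGroup M]
    [Module B M] (huniq : ∀ (N : Type u) [AddCommGroup N] [Module B N],
      IsSimpleModule B N → Nonempty (N ≃ₗ[B] M)) :
    ∃ n : ℕ, Nonempty ((B ⧸ Ring.jacobson B) ≃ₗ[B] (Fin n → M)) := by
  have : IsSemisimpleModule B (B ⧸ Ring.jacobson B) :=
    (IsArtinian.isSemisimpleModule_iff_jacobson B _).mpr (Module.jacobson_quotient_jacobson B B)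
  have hiso : IsIsotypicOfType B (B ⧸ Ring.jacobson B) M := fun m hm => huniq m hm
  exact hiso.linearEquiv_fun

/-- If the Artinian ring `B` has exactly one simple module and the projective cover of that module
is uniserial, then all left ideals of `B` are principal. -/
theorem isPrincipal_of_uniserial_projectiveCover [IsArtinianRing B] {M P : Type u} [AddCommGroup M]
    [Module B M] [AddCommGroup P] [Module B P] [IsSimpleModule B M]
    (huniq : ∀ (N : Type u) [AddCommGroup N] [Module B N],
      IsSimpleModule B N → Nonempty (N ≃ₗ[B] M))
    (hP : IsProjectiveCover B P M) (hU : IsUniserialModule B P) (I : Ideal B) :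
    I.IsPrincipal := by
  obtain ⟨hPN, -⟩ := hU.isNoetherian_isArtinian
  have hproj := hP.projective
  obtain ⟨N, ⟨ε⟩⟩ := hP.factor
  let q : P →ₗ[B] M := ε.toLinearMap.comp N.mkQ
  have hq : Function.Surjective q := ε.surjective.comp N.mkQ_surjective
  obtain ⟨n, ⟨δ⟩⟩ := exists_quotient_jacobson_equiv_pi huniq
  let π : B →ₗ[B] (Fin n → M) := δ.toLinearMap.comp (Submodule.mkQ (Ring.jacobson B))
  have hπ : Function.Surjective π := δ.surjective.comp (Submodule.mkQ_surjective _)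
  let Q : (Fin n → P) →ₗ[B] (Fin n → M) := LinearMap.pi fun i => q.comp (LinearMap.proj i)
  have hQ : Function.Surjective Q := fun m => by
    choose p hp using fun i => hq (m i)
    exact ⟨p, funext hp⟩
  have hprojn : Module.Projective B (Fin n → P) :=
    Module.Projective.of_equiv (DFinsupp.linearEquivFunOnFintype (R := B) (M := fun _ : Fin n => P))
  -- Both `B` and `P^n` are projective and map onto `M^n`. The lift `α : P^n → B` is onto and split
  -- by `σ`; the lift `β : B → P^n` is onto. So `I ⊆ B` embeds in `P^n`, is a quotient of it, and is
  -- generated by the image of `1`.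
  obtain ⟨α, hα⟩ := Module.projective_lifting_property π Q hπ
  have hαs : Function.Surjective α := by
    rw [← LinearMap.range_eq_top]
    by_contra hne
    obtain ⟨m, hm, hle⟩ := Ideal.exists_le_maximal _ hne
    refine hm.ne_top (eq_top_iff.mpr fun b _ => ?_)
    obtain ⟨p, hp⟩ := hQ (π b)
    have hb : b - α p ∈ Ring.jacobson B := by
      rw [← Submodule.Quotient.mk_eq_zero, ← Submodule.mkQ_apply]
      apply δ.injective
      have : π (b - α p) = 0 := by
        rw [map_sub, sub_eq_zero, ← hp, ← hα]; rfl
      rw [map_zero]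
      exact this
    have := m.add_mem (Ring.jacobson_le_of_isMaximal m hb) (hle ⟨p, rfl⟩)
    rwa [sub_add_cancel] at this
  obtain ⟨σ, hσ⟩ := Module.projective_lifting_property α LinearMap.id hαs
  have hσi : Function.Injective σ :=
    Function.LeftInverse.injective (g := α) fun b => LinearMap.congr_fun hσ b
  obtain ⟨β, hβ⟩ := Module.projective_lifting_property Q π hQ
  have hβs : Function.Surjective β := surjective_of_surjective_pi_comp hU.total hq fun m => by
    obtain ⟨b, hb⟩ := hπ m
    refine ⟨b, fun i => ?_⟩
    rw [← hb, ← hβ]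
    rfl
  obtain ⟨ψ, hψ⟩ := exists_surjective_of_injective_pi
    (fun X _ _ φ hφ => exists_surjective_of_injective_of_total huniq hU.total hq hφ) n I
    (σ.comp (Submodule.subtype I)) (hσi.comp (Submodule.injective_subtype I))
  refine ⟨(ψ (β 1) : I), le_antisymm (fun x hx => ?_) ?_⟩
  · obtain ⟨p, hp⟩ := hψ ⟨x, hx⟩
    obtain ⟨b, rfl⟩ := hβs p
    refine Submodule.mem_span_singleton.mpr ⟨b, ?_⟩
    rw [← Submodule.coe_smul, ← map_smul, ← map_smul, smul_eq_mul, mul_one, hp]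
  · rw [Submodule.span_singleton_le_iff_mem]
    exact (ψ (β 1)).2

end UniserialProjectiveCover

/-! ### Double annihilators -/

section Annihilator

variable {B : Type*} [Ring B]

/-- In a ring with the double annihilator property for left and for right ideals, all right ideals
are checkable if and only if all left ideals are principal. -/
theorem forall_isCheckable_iff_forall_isPrincipal
    (hl : ∀ (L : Ideal B) (x : B), x ∉ L → ∃ b, (∀ y ∈ L, y * b = 0) ∧ x * b ≠ 0)
    (hr : ∀ (I : Submodule Bᵐᵒᵖ B) (x : B), x ∉ I → ∃ b, (∀ y ∈ I, b * y = 0) ∧ b * x ≠ 0) :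
    (∀ I : Submodule Bᵐᵒᵖ B, IsCheckable I) ↔ ∀ L : Ideal B, L.IsPrincipal := by
  constructor
  · intro h L
    let R : Submodule Bᵐᵒᵖ B :=
      { carrier := {b | ∀ y ∈ L, y * b = 0}
        add_mem' := fun ha hb y hy => by rw [mul_add, ha y hy, hb y hy, add_zero]
        zero_mem' := fun y _ => mul_zero y
        smul_mem' := fun c b hb y hy => by
          rw [MulOpposite.smul_eq_mul_unop, ← mul_assoc, hb y hy, zero_mul] }
    obtain ⟨v, hv⟩ := h R
    have hv' : ∀ b, (∀ y ∈ L, y * b = 0) ↔ v * b = 0 := fun b => Set.ext_iff.mp hv b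
    -- `L` and `Bv` have the same right annihilator.
    refine ⟨v, le_antisymm (fun x hx => ?_) ?_⟩
    · by_contra hxv
      obtain ⟨b, hb, hxb⟩ := hl _ x hxv
      exact hxb ((hv' b).mpr (hb v (Submodule.mem_span_singleton_self v)) x hx)
    · rw [Submodule.span_singleton_le_iff_mem]
      by_contra hvL
      obtain ⟨b, hb, hvb⟩ := hl L v hvL
      exact hvb ((hv' b).mp hb)
  · intro h I
    let L : Ideal B :=
      { carrier := {b | ∀ y ∈ I, b * y = 0}
        add_mem' := fun ha hb y hy => by rw [add_mul, ha y hy, hb y hy, add_zero]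
        zero_mem' := fun y _ => zero_mul y
        smul_mem' := fun c b hb y hy => by rw [smul_eq_mul, mul_assoc, hb y hy, mul_zero] }
    obtain ⟨v, hv⟩ := h L
    have hvL : v ∈ L := hv ▸ Submodule.mem_span_singleton_self v
    refine ⟨v, Set.ext fun a => ⟨fun ha => hvL a ha, fun ha => ?_⟩⟩
    by_contra haI
    obtain ⟨b, hb, hba⟩ := hr I a haI
    have hbL : b ∈ L := hb
    rw [hv] at hbL
    obtain ⟨c, rfl⟩ := Submodule.mem_span_singleton.mp hbL
    refine hba ?_
    have ha' : v * a = 0 := ha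
    rw [smul_eq_mul, mul_assoc, ha', mul_zero]

end Annihilator

/-! ### The double annihilator property of group algebras -/

section GroupAlgebra

variable {K G : Type*} [Field K] [Group G] [Finite G]

/-- The element of the group algebra that represents a linear functional with respect to the form
given by the coefficient of `1`. -/
noncomputable def MonoidAlgebra.representing (φ : MonoidAlgebra K G →ₗ[K] K) : MonoidAlgebra K G :=
  MonoidAlgebra.ofCoeff (Finsupp.equivFunOnFinite.symm fun g => φ (MonoidAlgebra.single g⁻¹ 1))

theorem MonoidAlgebra.coeff_mul_representing (φ : MonoidAlgebra K G →ₗ[K] K)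
    (y : MonoidAlgebra K G) (g : G) :
    (y * representing φ).coeff g = φ (MonoidAlgebra.single g⁻¹ 1 * y) := by
  induction y using MonoidAlgebra.induction_linear with
  | zero => simp
  | add x y hx hy => rw [add_mul, coeff_add, Finsupp.add_apply, hx, hy, mul_add, map_add]
  | single h k =>
    rw [coeff_single_mul_apply, single_mul_single, one_mul,
      show single (g⁻¹ * h) k = k • single (g⁻¹ * h) (1 : K) by simp, map_smul]
    simp [representing]

theorem MonoidAlgebra.coeff_representing_mul (φ : MonoidAlgebra K G →ₗ[K] K)
    (y : MonoidAlgebra K G) (g : G) :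
    (representing φ * y).coeff g = φ (y * MonoidAlgebra.single g⁻¹ 1) := by
  induction y using MonoidAlgebra.induction_linear with
  | zero => simp
  | add x y hx hy => rw [mul_add, coeff_add, Finsupp.add_apply, hx, hy, add_mul, map_add]
  | single h k =>
    rw [coeff_mul_single_apply, single_mul_single, mul_one,
      show single (h * g⁻¹) k = k • single (h * g⁻¹) (1 : K) by simp, map_smul]
    simp [representing, mul_comm]

/-- Separate `x` from `L` by a functional `φ`. It vanishes on every `g⁻¹y` with `y ∈ L`, so all
coefficients of `y * representing φ` are zero, while the coefficient of `1` in `x * representing φ`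
is `φ x`. -/
theorem MonoidAlgebra.exists_left_annihilated (L : Ideal (MonoidAlgebra K G))
    {x : MonoidAlgebra K G} (hx : x ∉ L) : ∃ b, (∀ y ∈ L, y * b = 0) ∧ x * b ≠ 0 := by
  obtain ⟨φ, hφx, hφ⟩ := Submodule.exists_le_ker_of_notMem (p := L.restrictScalars K) hx
  refine ⟨representing φ, fun y hy => ?_, fun h => hφx ?_⟩
  · ext g
    rw [coeff_mul_representing]
    exact hφ (L.mul_mem_left _ hy)
  · have := coeff_mul_representing φ x 1
    rw [h, inv_one, ← MonoidAlgebra.one_def, one_mul] at this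
    exact this.symm

theorem MonoidAlgebra.exists_right_annihilated
    (I : Submodule (MonoidAlgebra K G)ᵐᵒᵖ (MonoidAlgebra K G))
    {x : MonoidAlgebra K G} (hx : x ∉ I) : ∃ b, (∀ y ∈ I, b * y = 0) ∧ b * x ≠ 0 := by
  let I' : Submodule K (MonoidAlgebra K G) :=
    { I.toAddSubmonoid with
      smul_mem' := fun k y hy => by
        have := I.smul_mem (MulOpposite.op (algebraMap K (MonoidAlgebra K G) k)) hy
        rw [MulOpposite.smul_eq_mul_unop, MulOpposite.unop_op, ← Algebra.commutes,
          ← Algebra.smul_def] at this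
        exact this }
  obtain ⟨φ, hφx, hφ⟩ := Submodule.exists_le_ker_of_notMem (p := I') hx
  refine ⟨representing φ, fun y hy => ?_, fun h => hφx ?_⟩
  · ext g
    rw [coeff_representing_mul]
    exact hφ (I.smul_mem (MulOpposite.op (MonoidAlgebra.single g⁻¹ 1)) hy)
  · have := coeff_representing_mul φ x 1
    rw [h, inv_one, ← MonoidAlgebra.one_def, mul_one] at this
    exact this.symm

end GroupAlgebra

/-! ### Passage to a block -/

section Block

namespace IsBlockIdempotent

variable {A : Type*} [Ring A] {f : A} (hf : IsBlockIdempotent f)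

include hf

theorem comm (a : A) : a * f = f * a := Subring.mem_center_iff.mp hf.mem_center a

theorem mul_coe (x : hf.Block) : f * x.1 = x.1 := congrArg Subtype.val (one_mul x)

theorem coe_mul (x : hf.Block) : x.1 * f = x.1 := congrArg Subtype.val (mul_one x)

/-- The projection of a ring onto a block. -/
def toBlock (a : A) : hf.Block := ⟨f * a * f, a, rfl⟩

theorem coe_toBlock_mul (a : A) (x : hf.Block) : (hf.toBlock a * x).1 = a * x.1 := by
  change f * a * f * x.1 = _
  rw [mul_assoc, hf.mul_coe, ← hf.comm, mul_assoc, hf.mul_coe]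

theorem coe_mul_toBlock (x : hf.Block) (a : A) : (x * hf.toBlock a).1 = x.1 * a := by
  change x.1 * (f * a * f) = _
  rw [← mul_assoc, ← mul_assoc, hf.coe_mul, mul_assoc, hf.comm, ← mul_assoc, hf.coe_mul]

/-- A left ideal of the block is also one of `A`, since `A` acts on the block through `toBlock`; the
annihilating element is then projected to the block. -/
theorem exists_left_annihilated
    (hl : ∀ (L : Ideal A) (x : A), x ∉ L → ∃ b, (∀ y ∈ L, y * b = 0) ∧ x * b ≠ 0)
    (L : Ideal hf.Block) (x : hf.Block) (hx : x ∉ L) :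
    ∃ b, (∀ y ∈ L, y * b = 0) ∧ x * b ≠ 0 := by
  let L' : Ideal A :=
    { carrier := {a | ∃ y ∈ L, y.1 = a}
      add_mem' := by rintro _ _ ⟨y, hy, rfl⟩ ⟨z, hz, rfl⟩; exact ⟨y + z, L.add_mem hy hz, rfl⟩
      zero_mem' := ⟨0, L.zero_mem, rfl⟩
      smul_mem' := by
        rintro c _ ⟨y, hy, rfl⟩
        exact ⟨hf.toBlock c * y, L.mul_mem_left _ hy, hf.coe_toBlock_mul c y⟩ }
  obtain ⟨b, hb, hxb⟩ := hl L' x.1 (by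
    rintro ⟨y, hy, hyx⟩
    exact hx (Subtype.ext hyx ▸ hy))
  refine ⟨hf.toBlock b, fun y hy => Subtype.ext ?_, fun h => hxb ?_⟩
  · rw [coe_mul_toBlock]
    exact hb _ ⟨y, hy, rfl⟩
  · rw [← hf.coe_mul_toBlock, h]
    rfl

theorem exists_right_annihilated
    (hr : ∀ (I : Submodule Aᵐᵒᵖ A) (x : A), x ∉ I → ∃ b, (∀ y ∈ I, b * y = 0) ∧ b * x ≠ 0)
    (I : Submodule (hf.Block)ᵐᵒᵖ hf.Block) (x : hf.Block) (hx : x ∉ I) :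
    ∃ b, (∀ y ∈ I, b * y = 0) ∧ b * x ≠ 0 := by
  let I' : Submodule Aᵐᵒᵖ A :=
    { carrier := {a | ∃ y ∈ I, y.1 = a}
      add_mem' := by rintro _ _ ⟨y, hy, rfl⟩ ⟨z, hz, rfl⟩; exact ⟨y + z, I.add_mem hy hz, rfl⟩
      zero_mem' := ⟨0, I.zero_mem, rfl⟩
      smul_mem' := by
        rintro c _ ⟨y, hy, rfl⟩
        exact ⟨y * hf.toBlock c.unop, I.smul_mem (MulOpposite.op (hf.toBlock c.unop)) hy,
          hf.coe_mul_toBlock y c.unop⟩ }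
  obtain ⟨b, hb, hxb⟩ := hr I' x.1 (by
    rintro ⟨y, hy, hyx⟩
    exact hx (Subtype.ext hyx ▸ hy))
  refine ⟨hf.toBlock b, fun y hy => Subtype.ext ?_, fun h => hxb ?_⟩
  · rw [coe_toBlock_mul]
    exact hb _ ⟨y, hy, rfl⟩
  · rw [← hf.coe_toBlock_mul, h]
    rfl

/-- A central idempotent `e` of the block is central in `A`, so `f = e + (f - e)` contradicts
primitivity unless one summand vanishes. -/
theorem eq_zero_or_eq_one (e : hf.Block) (he : IsIdempotentElem e) (hc : ∀ b, b * e = e * b) :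
    e = 0 ∨ e = 1 := by
  have he' : IsIdempotentElem e.1 := congrArg Subtype.val he.eq
  have hcen : e.1 ∈ Subring.center A := Subring.mem_center_iff.mpr fun a => by
    rw [← hf.coe_toBlock_mul, ← hf.coe_mul_toBlock, hc]
  have h1 : e.1 * (f - e.1) = 0 := by rw [mul_sub, hf.coe_mul, he'.eq, sub_self]
  have hid : IsIdempotentElem (f - e.1) := by
    rw [IsIdempotentElem, sub_mul, h1, sub_zero, mul_sub, hf.idem.eq, hf.mul_coe]
  rcases hf.primitive e.1 hcen (f - e.1) (Subring.sub_mem _ hf.mem_center hcen) he' hid h1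
    (by abel) with h | h
  · exact Or.inl (Subtype.ext h)
  · exact Or.inr (Subtype.ext (sub_eq_zero.mp h).symm)

end IsBlockIdempotent

end Block

theorem mainTheorem2 {K : Type u} {G : Type v} [Field K] [Finite K] [Group G] [Finite G]
    (p : ℕ) [CharP K p] (f : MonoidAlgebra K G) (hf : IsBlockIdempotent f) :
    List.TFAE [
      ∀ I : Submodule (hf.Block)ᵐᵒᵖ hf.Block, IsCheckable I,
      ∀ I : Ideal hf.Block, I.IsPrincipal,
      ∃ (M : Type (max u v)) (_ : AddCommGroup M) (_ : Module hf.Block M),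
        IsSimpleModule hf.Block M ∧
        (∀ (N : Type (max u v)) [AddCommGroup N] [Module hf.Block N],
          IsSimpleModule hf.Block N → Nonempty (N ≃ₗ[hf.Block] M)) ∧
        ∃ (P : Type (max u v)) (_ : AddCommGroup P) (_ : Module hf.Block P),
          IsProjectiveCover hf.Block P M ∧ IsUniserialModule hf.Block P] := by
  have : Finite (MonoidAlgebra K G) :=
    Finite.of_injective (fun x => (x.coeff : G → K))
      (DFunLike.coe_injective.comp MonoidAlgebra.coeff_injective)
  have : Finite hf.Block := Subtype.finite
  have : Nontrivial hf.Block := ⟨1, 0, fun h => hf.ne_zero (congrArg Subtype.val h)⟩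
  tfae_have 1 ↔ 2 := forall_isCheckable_iff_forall_isPrincipal
    (hf.exists_left_annihilated fun L _ hx => MonoidAlgebra.exists_left_annihilated L hx)
    (hf.exists_right_annihilated fun I _ hx => MonoidAlgebra.exists_right_annihilated I hx)
  tfae_have 2 → 3 := fun h => exists_uniserial_projectiveCover h hf.eq_zero_or_eq_one
  tfae_have 3 → 2 := by
    rintro ⟨M, _, _, hM, huniq, P, _, _, hP, hU⟩ I
    exact isPrincipal_of_uniserial_projectiveCover huniq hP hU I
  tfae_finish
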